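/- Let $Fm$ be the set of formulas in the language $\langle \land,\lor,\Rightarrow,\neg,0\rangle$ of type $\langle 2,2,2,1,0\rangle$ over a denumerable set of propositional variables, and write $1:=\neg 0$, $\varphi\Leftrightarrow\psi:=(\varphi\Rightarrow\psi)\land(\psi\Rightarrow\varphi)$, $\varphi*\psi:=\neg(\varphi\Rightarrow\neg\psi)$, $\varphi^2:=\varphi*\varphi$ and $\varphi\Rightarrow^2\psi:=\varphi\Rightarrow(\varphi\Rightarrow\psi)$. For a finite (possibly empty) list $\Delta=(\delta_1,\dots,\delta_n)$ of formulas write $\Delta\Rightarrow\varphi:=\delta_1\Rightarrow(\cdots\Rightarrow(\delta_n\Rightarrow\varphi)\cdots)$ and $\Delta\Rightarrow^2\varphi:=\delta_1\Rightarrow^2(\cdots\Rightarrow^2(\delta_n\Rightarrow^2\varphi)\cdots)$; both are $\varphi$ when $n=0$. Nelson's propositional logic $\mathcal S$ is given by the Hilbert-style calculus with the axiom schemata (A1) $\varphi\Rightarrow\varphi$; (A2) $0\Rightarrow\psi$; (A3) $\neg\varphi\Rightarrow(\varphi\Rightarrow 0)$; (A4) $1$; (A5) $(\varphi\Rightarrow\psi)\Leftrightarrow(\neg\psi\Rightarrow\neg\varphi)$;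 and the following rule schemata, where $\Delta$ is any finite list of formulas and "$X\,/\,Y$" means "from $X$ infer $Y$": - (P) $\Delta\Rightarrow(\varphi\Rightarrow(\psi\Rightarrow\gamma))\ /\ \Delta\Rightarrow(\psi\Rightarrow(\varphi\Rightarrow\gamma))$; - (C) $\varphi\Rightarrow(\varphi\Rightarrow(\varphi\Rightarrow\gamma))\ /\ \varphi\Rightarrow(\varphi\Rightarrow\gamma)$; - (E) $\Delta\Rightarrow\varphi,\ \varphi\Rightarrow\gamma\ /\ \Delta\Rightarrow\gamma$; - ($\Rightarrow$l) $\Delta\Rightarrow\varphi,\ \psi\Rightarrow\gamma\ /\ \Delta\Rightarrow((\varphi\Rightarrow\psi)\Rightarrow\gamma)$; - ($\Rightarrow$r) $\gamma\ /\ \varphi\Rightarrow\gamma$; - ($\land$l1) $\varphi\Rightarrow\gamma\ /\ (\varphi\land\psi)\Rightarrow\gamma$; - ($\land$l2) $\psi\Rightarrow\gamma\ /\ (\varphi\land\psi)\Rightarrow\gamma$; - ($\land$r) $\Delta\Rightarrow\varphi,\ \Delta\Rightarrow\psi\ /\ \Delta\Rightarrow(\varphi\land\psi)$; - ($\lor$l1)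 $\varphi\Rightarrow\gamma,\ \psi\Rightarrow\gamma\ /\ (\varphi\lor\psi)\Rightarrow\gamma$; - ($\lor$l2) $\varphi\Rightarrow^2\gamma,\ \psi\Rightarrow^2\gamma\ /\ (\varphi\lor\psi)\Rightarrow^2\gamma$; - ($\lor$r1) $\Delta\Rightarrow\varphi\ /\ \Delta\Rightarrow(\varphi\lor\psi)$; - ($\lor$r2) $\Delta\Rightarrow\psi\ /\ \Delta\Rightarrow(\varphi\lor\psi)$; - ($\neg{\Rightarrow}$l) $(\varphi\land\neg\psi)\Rightarrow\gamma\ /\ \neg(\varphi\Rightarrow\psi)\Rightarrow\gamma$; - ($\neg{\Rightarrow}$r) $\Delta\Rightarrow^2(\varphi\land\neg\psi)\ /\ \Delta\Rightarrow^2\neg(\varphi\Rightarrow\psi)$; - ($\neg\land$l) $(\neg\varphi\lor\neg\psi)\Rightarrow\gamma\ /\ \neg(\varphi\land\psi)\Rightarrow\gamma$; - ($\neg\land$r) $\Delta\Rightarrow(\neg\varphi\lor\neg\psi)\ /\ \Delta\Rightarrow\neg(\varphi\land\psi)$; - ($\neg\lor$l) $(\neg\varphi\land\neg\psi)\Rightarrow\gamma\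 /\ \neg(\varphi\lor\psi)\Rightarrow\gamma$; - ($\neg\lor$r) $\Delta\Rightarrow(\neg\varphi\land\neg\psi)\ /\ \Delta\Rightarrow\neg(\varphi\lor\psi)$; - ($\neg\neg$l) $\varphi\Rightarrow\gamma\ /\ \neg\neg\varphi\Rightarrow\gamma$; - ($\neg\neg$r) $\Delta\Rightarrow\varphi\ /\ \Delta\Rightarrow\neg\neg\varphi$. For $\Gamma\subseteq Fm$ and $\psi\in Fm$, write $\Gamma\vdash_{\mathcal S}\psi$ if there is a derivation (a finite sequence of formulas, each of which is a member of $\Gamma$, an instance of an axiom schema, or inferred from earlier members by an instance of a rule schema) ending in $\psi$. **Theorem (Deduction-Detachment Theorem).** For every (possibly infinite) set $\Gamma\subseteq Fm$ and all $\varphi,\psi\in Fm$, $$\Gamma\cup\{\varphi\}\vdash_{\mathcal S}\psi\quad\text{if and only if}\quad\Gamma\vdash_{\mathcal S}\varphi^2\Rightarrow\psi .$$ -/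

import Mathlib

namespace NelsonS

/-- Formulas in the language `⟨∧, ∨, ⇒, ¬, 0⟩` of type `⟨2, 2, 2, 1, 0⟩`, freely generated by
denumerably many propositional variables. -/
inductive Formula : Type
  | var : ℕ → Formula
  | and : Formula → Formula → Formula
  | or : Formula → Formula → Formula
  | imp : Formula → Formula → Formula
  | neg : Formula → Formula
  | zero : Formula

infixr:60 " ⇒ " => Formula.imp
infixr:65 " ⋎ " => Formula.or
infixr:70 " ⋏ " => Formula.and
prefix:80 "∼" => Formula.neg

namespace Formula

/-- `1 := ¬0`. -/
def one : Formula := ∼zero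

/-- `φ ⇔ ψ := (φ ⇒ ψ) ∧ (ψ ⇒ φ)`. -/
def iff (φ ψ : Formula) : Formula := (φ ⇒ ψ) ⋏ (ψ ⇒ φ)

/-- `φ * ψ := ¬(φ ⇒ ¬ψ)`. -/
def mul (φ ψ : Formula) : Formula := ∼(φ ⇒ ∼ψ)

/-- `φ² := φ * φ`. -/
def sq (φ : Formula) : Formula := mul φ φ

/-- `φ ⇒² ψ := φ ⇒ (φ ⇒ ψ)`. -/
def imp2 (φ ψ : Formula) : Formula := φ ⇒ (φ ⇒ ψ)

/-- `Γ ⇒ φ := φ₁ ⇒ (φ₂ ⇒ (… ⇒ (φₙ ⇒ φ)…))` for a finite list `Γ = (φ₁, …, φₙ)`. -/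
def listImp (Γ : List Formula) (φ : Formula) : Formula := Γ.foldr imp φ

/-- `Γ ⇒² φ := φ₁ ⇒² (φ₂ ⇒² (… ⇒² (φₙ ⇒² φ)…))` for a finite list `Γ = (φ₁, …, φₙ)`. -/
def listImp2 (Γ : List Formula) (φ : Formula) : Formula := Γ.foldr imp2 φ

end Formula

open Formula in
/-- `Derives T φ` is `T ⊢ φ`: there is a derivation of `φ` from the set of assumptions `T` in
Nelson's Hilbert-style calculus for the propositional logic `S`. -/
inductive Derives (T : Set Formula) : Formula → Prop
  | hyp {φ : Formula} (h : φ ∈ T) : Derives T φ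
  -- axiom schemata
  | A1 (φ : Formula) : Derives T (φ ⇒ φ)
  | A2 (ψ : Formula) : Derives T (zero ⇒ ψ)
  | A3 (φ : Formula) : Derives T (∼φ ⇒ (φ ⇒ zero))
  | A4 : Derives T one
  | A5 (φ ψ : Formula) : Derives T (iff (φ ⇒ ψ) (∼ψ ⇒ ∼φ))
  -- rule schemata
  | P (Γ : List Formula) (φ ψ γ : Formula) (h : Derives T (listImp Γ (φ ⇒ (ψ ⇒ γ)))) :
      Derives T (listImp Γ (ψ ⇒ (φ ⇒ γ)))
  | C (φ γ : Formula) (h : Derives T (φ ⇒ (φ ⇒ (φ ⇒ γ)))) : Derives T (φ ⇒ (φ ⇒ γ))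
  | E (Γ : List Formula) (φ γ : Formula) (h₁ : Derives T (listImp Γ φ))
      (h₂ : Derives T (φ ⇒ γ)) : Derives T (listImp Γ γ)
  | imp_l (Γ : List Formula) (φ ψ γ : Formula) (h₁ : Derives T (listImp Γ φ))
      (h₂ : Derives T (ψ ⇒ γ)) : Derives T (listImp Γ ((φ ⇒ ψ) ⇒ γ))
  | imp_r (φ γ : Formula) (h : Derives T γ) : Derives T (φ ⇒ γ)
  | and_l1 (φ ψ γ : Formula) (h : Derives T (φ ⇒ γ)) : Derives T ((φ ⋏ ψ) ⇒ γ)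
  | and_l2 (φ ψ γ : Formula) (h : Derives T (ψ ⇒ γ)) : Derives T ((φ ⋏ ψ) ⇒ γ)
  | and_r (Γ : List Formula) (φ ψ : Formula) (h₁ : Derives T (listImp Γ φ))
      (h₂ : Derives T (listImp Γ ψ)) : Derives T (listImp Γ (φ ⋏ ψ))
  | or_l1 (φ ψ γ : Formula) (h₁ : Derives T (φ ⇒ γ)) (h₂ : Derives T (ψ ⇒ γ)) :
      Derives T ((φ ⋎ ψ) ⇒ γ)
  | or_l2 (φ ψ γ : Formula) (h₁ : Derives T (imp2 φ γ)) (h₂ : Derives T (imp2 ψ γ)) :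
      Derives T (imp2 (φ ⋎ ψ) γ)
  | or_r1 (Γ : List Formula) (φ ψ : Formula) (h : Derives T (listImp Γ φ)) :
      Derives T (listImp Γ (φ ⋎ ψ))
  | or_r2 (Γ : List Formula) (φ ψ : Formula) (h : Derives T (listImp Γ ψ)) :
      Derives T (listImp Γ (φ ⋎ ψ))
  | neg_imp_l (φ ψ γ : Formula) (h : Derives T ((φ ⋏ ∼ψ) ⇒ γ)) : Derives T (∼(φ ⇒ ψ) ⇒ γ)
  | neg_imp_r (Γ : List Formula) (φ ψ : Formula) (h : Derives T (listImp2 Γ (φ ⋏ ∼ψ))) :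
      Derives T (listImp2 Γ (∼(φ ⇒ ψ)))
  | neg_and_l (φ ψ γ : Formula) (h : Derives T ((∼φ ⋎ ∼ψ) ⇒ γ)) : Derives T (∼(φ ⋏ ψ) ⇒ γ)
  | neg_and_r (Γ : List Formula) (φ ψ : Formula) (h : Derives T (listImp Γ (∼φ ⋎ ∼ψ))) :
      Derives T (listImp Γ (∼(φ ⋏ ψ)))
  | neg_or_l (φ ψ γ : Formula) (h : Derives T ((∼φ ⋏ ∼ψ) ⇒ γ)) : Derives T (∼(φ ⋎ ψ) ⇒ γ)
  | neg_or_r (Γ : List Formula) (φ ψ : Formula) (h : Derives T (listImp Γ (∼φ ⋏ ∼ψ))) :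
      Derives T (listImp Γ (∼(φ ⋎ ψ)))
  | neg_neg_l (φ γ : Formula) (h : Derives T (φ ⇒ γ)) : Derives T (∼(∼φ) ⇒ γ)
  | neg_neg_r (Γ : List Formula) (φ : Formula) (h : Derives T (listImp Γ φ)) :
      Derives T (listImp Γ (∼(∼φ)))

end NelsonS

/-!
The deduction direction rests on a stronger induction hypothesis of the right shape: if `χ` is
derivable from `Γ ∪ {φ}`, then `φ ⇒² χ`, that is `φ ⇒ (φ ⇒ χ)`, is derivable from `Γ`
(`Derives.imp2_of_insert`). Two copies of `φ` are what the calculus can sustain: a rule with two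
premises produces four copies, and (C) reduces these to two again (`Derives.absorb`). The rules
that carry a context `Δ` are applied with `φ` prepended to `Δ`; in particular (¬⇒r), the only rule
whose context is doubled, is met exactly because the hypothesis reads `φ ⇒² χ`. The left rules
without a context are applied after permuting the two copies of `φ` into the succedent.

The passage from `φ ⇒ (φ ⇒ ψ)` to `φ² ⇒ ψ` is residuation, obtained from contraposition (A5) and
double negation. For detachment, `φ` yields `φ ∧ ¬¬φ`, whence `φ² = ¬(φ ⇒ ¬φ)` by (¬⇒r).
-/

namespace NelsonS

namespace Derives

open Formula

variable {T : Set Formula} {φ ψ χ α β γ : Formula}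

theorem mono {S : Set Formula} (hTS : T ⊆ S) (h : Derives T χ) : Derives S χ := by
  induction h with
  | hyp h => exact hyp (hTS h)
  | A1 φ => exact A1 φ
  | A2 ψ => exact A2 ψ
  | A3 φ => exact A3 φ
  | A4 => exact A4
  | A5 φ ψ => exact A5 φ ψ
  | P Δ φ ψ γ _ ih => exact P Δ φ ψ γ ih
  | C φ γ _ ih => exact C φ γ ih
  | E Δ φ γ _ _ ih₁ ih₂ => exact E Δ φ γ ih₁ ih₂
  | imp_l Δ φ ψ γ _ _ ih₁ ih₂ => exact imp_l Δ φ ψ γ ih₁ ih₂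
  | imp_r φ γ _ ih => exact imp_r φ γ ih
  | and_l1 φ ψ γ _ ih => exact and_l1 φ ψ γ ih
  | and_l2 φ ψ γ _ ih => exact and_l2 φ ψ γ ih
  | and_r Δ φ ψ _ _ ih₁ ih₂ => exact and_r Δ φ ψ ih₁ ih₂
  | or_l1 φ ψ γ _ _ ih₁ ih₂ => exact or_l1 φ ψ γ ih₁ ih₂
  | or_l2 φ ψ γ _ _ ih₁ ih₂ => exact or_l2 φ ψ γ ih₁ ih₂
  | or_r1 Δ φ ψ _ ih => exact or_r1 Δ φ ψ ih
  | or_r2 Δ φ ψ _ ih => exact or_r2 Δ φ ψ ih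
  | neg_imp_l φ ψ γ _ ih => exact neg_imp_l φ ψ γ ih
  | neg_imp_r Δ φ ψ _ ih => exact neg_imp_r Δ φ ψ ih
  | neg_and_l φ ψ γ _ ih => exact neg_and_l φ ψ γ ih
  | neg_and_r Δ φ ψ _ ih => exact neg_and_r Δ φ ψ ih
  | neg_or_l φ ψ γ _ ih => exact neg_or_l φ ψ γ ih
  | neg_or_r Δ φ ψ _ ih => exact neg_or_r Δ φ ψ ih
  | neg_neg_l φ γ _ ih => exact neg_neg_l φ γ ih
  | neg_neg_r Δ φ _ ih => exact neg_neg_r Δ φ ih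

theorem mp (h : Derives T (φ ⇒ ψ)) (hφ : Derives T φ) : Derives T ψ :=
  E [] φ ψ hφ h

theorem swap (h : Derives T (φ ⇒ (ψ ⇒ γ))) : Derives T (ψ ⇒ (φ ⇒ γ)) :=
  P [] φ ψ γ h

theorem swap_imp2 (h : Derives T (imp2 φ (α ⇒ γ))) : Derives T (α ⇒ imp2 φ γ) :=
  swap (P [φ] φ α γ h)

theorem imp2_swap (h : Derives T (α ⇒ imp2 φ γ)) : Derives T (imp2 φ (α ⇒ γ)) :=
  P [φ] α φ γ (swap h)

theorem imp2_swap_imp2 (h : Derives T (imp2 φ (imp2 α γ))) :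
    Derives T (imp2 α (imp2 φ γ)) :=
  P [α] φ α _ (P [α, φ] φ α γ (swap_imp2 h))

theorem imp2_of (h : Derives T χ) : Derives T (imp2 φ χ) :=
  imp_r _ _ (imp_r _ _ h)

theorem imp2_mp (h : Derives T (imp2 φ α)) (hαβ : Derives T (α ⇒ β)) : Derives T (imp2 φ β) :=
  E [φ, φ] α β h hαβ

theorem weakening : Derives T (γ ⇒ (α ⇒ γ)) :=
  swap (imp_r _ _ (A1 γ))

/-- Three premises `α` contract to two, as a theorem rather than as the rule (C). -/
theorem contraction :
    Derives T ((α ⇒ (α ⇒ (α ⇒ γ))) ⇒ (α ⇒ (α ⇒ γ))) := by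
  -- Moving the antecedent innermost makes the formula an instance of the conclusion of (C).
  have h : Derives T (imp2 α ((α ⇒ (α ⇒ (α ⇒ γ))) ⇒ γ)) :=
    C _ _ (P [α, α] _ _ _ (P [α] _ _ _ (swap (A1 (α ⇒ (α ⇒ (α ⇒ γ)))))))
  exact swap_imp2 h

theorem listImp_pull (A Δ : List Formula)
    (h : Derives T (listImp A (listImp Δ (φ ⇒ γ)))) :
    Derives T (listImp A (φ ⇒ listImp Δ γ)) := by
  induction Δ generalizing A with
  | nil => exact h
  | cons δ Δ ih =>
    have h' := ih (A ++ [δ]) (by simpa [listImp] using h)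
    exact P A δ φ _ (by simpa [listImp] using h')

/-- Two copies of `φ` arising on the right of a context are absorbed by the two copies already on
its left. -/
theorem absorb (Δ : List Formula) (h : Derives T (imp2 φ (listImp Δ (imp2 φ γ)))) :
    Derives T (imp2 φ (listImp Δ γ)) :=
  C _ _ (C _ _ (listImp_pull [φ, φ, φ] Δ (listImp_pull [φ, φ] Δ h)))

theorem imp2_of_insert (h : Derives (T ∪ {φ}) χ) : Derives T (imp2 φ χ) := by
  induction h with
  | @hyp χ h =>
    rcases h with h | h
    · exact imp2_of (hyp h)
    · rw [Set.mem_singleton_iff.mp h]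
      exact imp_r _ _ (A1 φ)
  | A1 α => exact imp2_of (A1 α)
  | A2 α => exact imp2_of (A2 α)
  | A3 α => exact imp2_of (A3 α)
  | A4 => exact imp2_of A4
  | A5 α β => exact imp2_of (A5 α β)
  | P Δ α β γ _ ih => exact P (φ :: φ :: Δ) α β γ ih
  | C α γ _ ih => exact imp2_mp ih contraction
  | E Δ α γ _ _ ih₁ ih₂ => exact absorb Δ (E (φ :: φ :: Δ) α _ ih₁ (swap_imp2 ih₂))
  | imp_l Δ α β γ _ _ ih₁ ih₂ =>
    have h := imp_l (φ :: φ :: Δ) α β _ ih₁ (swap_imp2 ih₂)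
    simpa [listImp] using absorb (Δ ++ [α ⇒ β]) (by simpa [listImp, imp2] using h)
  | imp_r α γ _ ih => exact imp2_mp ih weakening
  | and_l1 α β γ _ ih => exact imp2_swap (and_l1 _ _ _ (swap_imp2 ih))
  | and_l2 α β γ _ ih => exact imp2_swap (and_l2 _ _ _ (swap_imp2 ih))
  | and_r Δ α β _ _ ih₁ ih₂ => exact and_r (φ :: φ :: Δ) α β ih₁ ih₂
  | or_l1 α β γ _ _ ih₁ ih₂ => exact imp2_swap (or_l1 _ _ _ (swap_imp2 ih₁) (swap_imp2 ih₂))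
  | or_l2 α β γ _ _ ih₁ ih₂ =>
    exact imp2_swap_imp2 (or_l2 _ _ _ (imp2_swap_imp2 ih₁) (imp2_swap_imp2 ih₂))
  | or_r1 Δ α β _ ih => exact or_r1 (φ :: φ :: Δ) α β ih
  | or_r2 Δ α β _ ih => exact or_r2 (φ :: φ :: Δ) α β ih
  | neg_imp_l α β γ _ ih => exact imp2_swap (neg_imp_l _ _ _ (swap_imp2 ih))
  -- The context here is read by `listImp2`, so a single `φ` stands for both copies.
  | neg_imp_r Δ α β _ ih => exact neg_imp_r (φ :: Δ) α β ih
  | neg_and_l α β γ _ ih => exact imp2_swap (neg_and_l _ _ _ (swap_imp2 ih))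
  | neg_and_r Δ α β _ ih => exact neg_and_r (φ :: φ :: Δ) α β ih
  | neg_or_l α β γ _ ih => exact imp2_swap (neg_or_l _ _ _ (swap_imp2 ih))
  | neg_or_r Δ α β _ ih => exact neg_or_r (φ :: φ :: Δ) α β ih
  | neg_neg_l α γ _ ih => exact imp2_swap (neg_neg_l _ _ (swap_imp2 ih))
  | neg_neg_r Δ α _ ih => exact neg_neg_r (φ :: φ :: Δ) α ih

theorem contrapose : Derives T ((φ ⇒ ψ) ⇒ (∼ψ ⇒ ∼φ)) :=
  mp (and_l1 _ _ _ (A1 _)) (A5 φ ψ)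

/-- One half of residuation, for the fusion of `φ` with itself. -/
theorem sq_imp_of_imp2 (h : Derives T (imp2 φ ψ)) : Derives T (sq φ ⇒ ψ) := by
  have h₁ : Derives T (∼ψ ⇒ (φ ⇒ ∼φ)) := swap (E [φ] _ _ h contrapose)
  have h₂ : Derives T (sq φ ⇒ ∼(∼ψ)) := mp contrapose h₁
  exact E [sq φ] _ _ h₂ (neg_neg_l _ _ (A1 ψ))

theorem sq (h : Derives T φ) : Derives T (sq φ) :=
  neg_imp_r [] _ _ (and_r [] _ _ h (neg_neg_r [] _ h))

end Derives

end NelsonS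

theorem mainTheorem5 (Γ : Set NelsonS.Formula) (φ ψ : NelsonS.Formula) :
    NelsonS.Derives (Γ ∪ {φ}) ψ ↔ NelsonS.Derives Γ (NelsonS.Formula.sq φ ⇒ ψ) := by
  constructor
  · exact fun h => h.imp2_of_insert.sq_imp_of_imp2
  · exact fun h => (h.mono Set.subset_union_left).mp (NelsonS.Derives.hyp (Or.inr rfl)).sq
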